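/- Let $\alpha_0,\alpha_1,\kappa>0$ and $\gamma>1$. Let $a,V:\mathbb R\to[0,1]$ be such that $\sqrt a$ and $V$ are $\kappa$-Lipschitz continuous, and let $G:\mathbb R\to\mathbb R$ be convex with $G(0)=0$ and $$\alpha_0|p|^\gamma-\tfrac1{\alpha_0}\le G(p)\le\alpha_1(|p|^\gamma+1),\qquad |G(p)-G(q)|\le\alpha_1(|p|+|q|+1)^{\gamma-1}|p-q|\qquad\text{for all }p,q\in\mathbb R.$$ Let $\lambda>\beta>0$ and, for $\theta\in\mathbb R$ and an open set $I\subseteq\mathbb R$, consider the equation $$-a(x)u''+G(\theta+u')+\beta V(x)=\lambda\qquad\text{in } I, \tag{1}$$ where sub- and supersolutions are understood in the viscosity sense, and a solution is a (continuous) function that is both a sub- and a supersolution. (a) Let $y,\theta\in\mathbb R$. Let $u:\mathbb R\to\mathbb R$ be lower semicontinuous and $v:\mathbb R\to\mathbb R$ upper semicontinuous, respectively a super- and a subsolution of (1) in $I=\mathbb R\setminus\{y\}$, with $$\limsup_{|x|\to+\infty}\frac{v(x)}{1+|x|}\le 0\le\liminf_{|x|\to+\infty}\frac{u(x)}{1+|x|}.$$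 Then: (i) if $\theta>0$, then $(v-u)(x)\le(v-u)(y)$ for every $x\ge y$; (ii) if $\theta<0$, then $(v-u)(x)\le(v-u)(y)$ for every $x\le y$; (iii) if $\theta=0$ and $v$ is Lipschitz continuous on $\mathbb R$, then $(v-u)(x)\le(v-u)(y)$ for every $x\in\mathbb R$. (b) Let $\theta\ne0$ and let $u_1,u_2$ be solutions of (1) in $I=\mathbb R$ with $\lim_{|x|\to+\infty}\frac{u_i(x)}{1+|x|}=0$ for $i=1,2$. Then $u_1-u_2$ is constant on $\mathbb R$. -/

import Mathlib

open Set Filter Topology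
open scoped NNReal

/-- Viscosity subsolutions of `F(x, u', u'') = 0` in an open set `I ⊆ ℝ`: upper semicontinuous in
`I`, and `F(x, φ'(x), φ''(x)) ≤ 0` whenever `φ ∈ C²` and `v - φ` has a local maximum at `x ∈ I`. -/
def IsViscositySubsolution (F : ℝ → ℝ → ℝ → ℝ) (I : Set ℝ) (v : ℝ → ℝ) : Prop :=
  UpperSemicontinuousOn v I ∧
    ∀ φ : ℝ → ℝ, ContDiff ℝ 2 φ → ∀ x ∈ I, IsLocalMax (fun z => v z - φ z) x →
      F x (deriv φ x) (deriv (deriv φ) x) ≤ 0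

/-- Viscosity supersolutions of `F(x, u', u'') = 0` in an open set `I ⊆ ℝ`: lower semicontinuous in
`I`, and `F(x, φ'(x), φ''(x)) ≥ 0` whenever `φ ∈ C²` and `u - φ` has a local minimum at `x ∈ I`. -/
def IsViscositySupersolution (F : ℝ → ℝ → ℝ → ℝ) (I : Set ℝ) (u : ℝ → ℝ) : Prop :=
  LowerSemicontinuousOn u I ∧
    ∀ φ : ℝ → ℝ, ContDiff ℝ 2 φ → ∀ x ∈ I, IsLocalMin (fun z => u z - φ z) x →
      0 ≤ F x (deriv φ x) (deriv (deriv φ) x)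

/-- Viscosity solutions: both sub- and supersolutions (in particular continuous in `I`). -/
def IsViscositySolution (F : ℝ → ℝ → ℝ → ℝ) (I : Set ℝ) (u : ℝ → ℝ) : Prop :=
  IsViscositySubsolution F I u ∧ IsViscositySupersolution F I u

/-- The operator of the equation `-a(x) u'' + G(θ + u') + β V(x) = l`, where `p` and `X` stand for
`u'` and `u''`. -/
def viscousHJ (a V G : ℝ → ℝ) (β l θ : ℝ) : ℝ → ℝ → ℝ → ℝ :=
  fun x p X => -a x * X + G (θ + p) + β * V x - l

/-- The filter `|x| → +∞` on `ℝ`. -/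
def absAtTop : Filter ℝ := comap (fun x : ℝ => |x|) atTop

/-- Sublinear growth: `u(x) / (1 + |x|) → 0` as `|x| → +∞`. -/
def IsSublinear (u : ℝ → ℝ) : Prop :=
  Tendsto (fun x => u x / (1 + |x|)) absAtTop (𝓝 0)

/-- `limsup_{|x| → +∞} v(x) / (1 + |x|) ≤ 0`, the upper limit being taken in `[-∞, +∞]`. -/
def HasSublinearUpperGrowth (v : ℝ → ℝ) : Prop :=
  limsup (fun x => ((v x / (1 + |x|) : ℝ) : EReal)) absAtTop ≤ 0

/-- `0 ≤ liminf_{|x| → +∞} u(x) / (1 + |x|)`, the lower limit being taken in `[-∞, +∞]`. -/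
def HasSublinearLowerGrowth (u : ℝ → ℝ) : Prop :=
  0 ≤ liminf (fun x => ((u x / (1 + |x|) : ℝ) : EReal)) absAtTop

/-! Since `V ≤ 1`, a linear function of slope `b` with `G (θ + b) + β < l` is a strict subsolution
on all of `ℝ`. As `G` is convex, `(1 - ε) v + ε b x` is a strict subsolution off `y`. In the
direction where `b x → -∞` the linear term beats the sublinear growth of `v` and `u`, so comparison
on a long interval with one end at `y` puts the maximum of the difference at `y`; then `ε → 0`
(`comparison_halfLine`). Because `G 0 = 0` and `β < l`, the slope `b = -θ` is always admissible; it
decreases to the right if `θ > 0` and to the left if `θ < 0`. For `θ = 0` small slopes of both signs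
are admissible. In (b) every `y` may serve as base point and the two solutions may be exchanged, so
all these inequalities become equalities.

The analytic core is `strict_comparison_Icc`, where `a` may vanish. Doubling variables is reduced to
one variable: with sup-convolutions `f`, `g` of `v` and `-u`, maximising `f z + g z` over `z`
realises the penalty `n / 4 (x - y)²`. Both are semiconvex, so Jensen's lemma gives, after a small
tilt, a maximum at which both have second-order expansions. These transfer to families of parabolas
touching `v` and `-u`, and the Lipschitz bound on `√a` controls the mismatch of the diffusion terms.
-/

/-! ### Second-order expansions of convex functions -/

/-- `f(w) = f(z) + p (w - z) + X / 2 (w - z)² + o((w - z)²)` as `w → z`. -/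
def HasSecondOrderExpansion (f : ℝ → ℝ) (z p X : ℝ) : Prop :=
  ∀ η > 0, ∀ᶠ w in 𝓝 z, |f w - f z - p * (w - z) - X / 2 * (w - z) ^ 2| ≤ η * (w - z) ^ 2

theorem HasSecondOrderExpansion.sub_parabola {f : ℝ → ℝ} {n z p X : ℝ}
    (h : HasSecondOrderExpansion (fun z => f z + n / 2 * z ^ 2) z p X) :
    HasSecondOrderExpansion f z (p - n * z) (X - n) := by
  intro η hη
  filter_upwards [h η hη] with w hw
  convert hw using 2
  ring

theorem eq_zero_of_eventually_mul_le_sq {s C z : ℝ}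
    (h : ∀ᶠ w in 𝓝 z, s * (w - z) ≤ C * (w - z) ^ 2) : s = 0 := by
  have hmax : IsLocalMax (fun w => s * (w - z) - C * (w - z) ^ 2) z := by
    filter_upwards [h] with w hw
    simp only [sub_self]
    linarith
  have hd : HasDerivAt (fun w => s * (w - z) - C * (w - z) ^ 2)
      (s * 1 - C * (2 * (z - z) ^ 1 * 1)) z :=
    (((hasDerivAt_id z).sub_const z).const_mul s).sub
      ((((hasDerivAt_id z).sub_const z).pow 2).const_mul C)
  simpa using hmax.hasDerivAt_eq_zero hd

theorem nonpos_of_eventually_mul_sq_le_zero {X z : ℝ}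
    (h : ∀ᶠ w in 𝓝 z, X * (w - z) ^ 2 ≤ 0) : X ≤ 0 := by
  obtain ⟨w, hw, hne⟩ := ((h.filter_mono (nhdsWithin_le_nhds (s := {z}ᶜ))).and
    self_mem_nhdsWithin).exists
  have : 0 < (w - z) ^ 2 := by
    have : w - z ≠ 0 := sub_ne_zero.2 hne
    positivity
  by_contra hX
  nlinarith [mul_pos (not_le.1 hX) this]

theorem le_of_rightDeriv_le {f g f' g' : ℝ → ℝ} {x y : ℝ} (hxy : x ≤ y)
    (hf : Continuous f) (hg : Continuous g)
    (hf' : ∀ t ∈ Ico x y, HasDerivWithinAt f (f' t) (Ici t) t)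
    (hg' : ∀ t ∈ Ico x y, HasDerivWithinAt g (g' t) (Ici t) t)
    (h : ∀ t ∈ Ico x y, f' t ≤ g' t) : f y - f x ≤ g y - g x := by
  have := image_le_of_deriv_right_le_deriv_boundary (f := f) (f' := f') (a := x) (b := y)
    (B := fun t => g t - g x + f x) (B' := g') hf.continuousOn hf' (by simp) (by fun_prop)
    (fun t ht => ((hg' t ht).sub_const _).add_const _) h (right_mem_Icc.2 hxy)
  linarith

theorem ConvexOn.ae_hasSecondOrderExpansion {c : ℝ → ℝ} (hc : ConvexOn ℝ univ c) :
    ∀ᵐ z, ∃ p X, HasSecondOrderExpansion c z p X := by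
  set r : ℝ → ℝ := fun x => derivWithin c (Ioi x) x with hr
  have hcont : Continuous c := by
    rw [← continuousOn_univ]; exact hc.continuousOn isOpen_univ
  have hmono : Monotone r := by
    have := hc.monotoneOn_rightDeriv
    rw [interior_univ] at this
    exact monotoneOn_univ.1 this
  have hder : ∀ t, HasDerivWithinAt c (r t) (Ici t) t := fun t =>
    (hc.hasDerivWithinAt_rightDeriv_of_mem_interior (by simp)).Ici_of_Ioi
  filter_upwards [hmono.ae_differentiableAt] with z hz
  refine ⟨r z, deriv r z, fun η hη => ?_⟩
  set X := deriv r z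
  have hlo := (hasDerivAt_iff_isLittleO.1 hz.hasDerivAt).def hη
  obtain ⟨δ, hδ, hball⟩ := Metric.eventually_nhds_iff.1 hlo
  have hb : ∀ t, |t - z| < δ → |r t - r z - (t - z) * X| ≤ η * |t - z| := fun t ht => by
    simpa using hball (by rwa [Real.dist_eq])
  have hq : ∀ Y t, HasDerivWithinAt (fun w => r z * (w - z) + Y / 2 * (w - z) ^ 2)
      (r z + Y * (t - z)) (Ici t) t := fun Y t => by
    have : HasDerivAt (fun w => r z * (w - z) + Y / 2 * (w - z) ^ 2)
      (r z * 1 + Y / 2 * (2 * (t - z) ^ 1 * 1)) t :=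
      (((hasDerivAt_id t).sub_const z).const_mul (r z)).add
        ((((hasDerivAt_id t).sub_const z).pow 2).const_mul (Y / 2))
    exact (this.congr_deriv (by ring)).hasDerivWithinAt
  have hqc : ∀ Y, Continuous (fun w => r z * (w - z) + Y / 2 * (w - z) ^ 2) := fun Y => by
    fun_prop
  refine Metric.eventually_nhds_iff.2 ⟨δ, hδ, fun w hw => ?_⟩
  rw [Real.dist_eq] at hw
  have hsq : 0 ≤ η * (w - z) ^ 2 := by positivity
  rcases le_total z w with hzw | hzw
  · have key : ∀ t ∈ Ico z w, |r t - r z - (t - z) * X| ≤ η * (t - z) := fun t ht => by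
      rw [abs_of_nonneg (by linarith)] at hw
      have := hb t (by rw [abs_of_nonneg (by linarith [ht.1])]; linarith [ht.2])
      rwa [abs_of_nonneg (by linarith [ht.1] : 0 ≤ t - z)] at this
    have h1 := le_of_rightDeriv_le hzw hcont (hqc (X + η)) (fun t _ => hder t)
      (fun t _ => hq (X + η) t) fun t ht => by nlinarith [(abs_le.1 (key t ht)).2]
    have h2 := le_of_rightDeriv_le hzw (hqc (X - η)) hcont (fun t _ => hq (X - η) t)
      (fun t _ => hder t) fun t ht => by nlinarith [(abs_le.1 (key t ht)).1]
    simp only [sub_self] at h1 h2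
    rw [abs_le]
    constructor <;> nlinarith
  · have key : ∀ t ∈ Ico w z, |r t - r z - (t - z) * X| ≤ η * (z - t) := fun t ht => by
      rw [abs_of_nonpos (by linarith)] at hw
      have := hb t (by rw [abs_of_nonpos (by linarith [ht.2])]; linarith [ht.1])
      rwa [abs_of_nonpos (by linarith [ht.2] : t - z ≤ 0), neg_sub] at this
    have h1 := le_of_rightDeriv_le hzw (hqc (X + η)) hcont
      (fun t _ => hq (X + η) t) (fun t _ => hder t) fun t ht => by
        nlinarith [(abs_le.1 (key t ht)).1]
    have h2 := le_of_rightDeriv_le hzw hcont (hqc (X - η)) (fun t _ => hder t)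
      (fun t _ => hq (X - η) t) fun t ht => by nlinarith [(abs_le.1 (key t ht)).2]
    simp only [sub_self] at h1 h2
    rw [abs_le]
    constructor <;> nlinarith

/-! ### Jensen's lemma -/

/-- A convex function touched from above by a parabola lies above the tangent line. -/
theorem ConvexOn.tangent_le_of_eventually_le {H : ℝ → ℝ} (hH : ConvexOn ℝ univ H) {z s C : ℝ}
    (h : ∀ᶠ w in 𝓝 z, H w ≤ H z + s * (w - z) + C * (w - z) ^ 2) (w : ℝ) :
    H z + s * (w - z) ≤ H w := by
  -- `z` lies between `w` and the point `z - t (w - z)`, where the parabola bounds `H`. Convexity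
  -- then bounds `H w` from below up to an error of order `t`.
  have hlim : Tendsto (fun t : ℝ => z - t * (w - z)) (𝓝[>] 0) (𝓝 z) := by
    have : Continuous (fun t : ℝ => z - t * (w - z)) := by fun_prop
    simpa using (this.tendsto 0).mono_left nhdsWithin_le_nhds
  have hlim' : Tendsto (fun t : ℝ => H w - s * (w - z) + C * t * (w - z) ^ 2) (𝓝[>] 0)
      (𝓝 (H w - s * (w - z))) := by
    have : Continuous (fun t : ℝ => H w - s * (w - z) + C * t * (w - z) ^ 2) := by fun_prop
    simpa using (this.tendsto 0).mono_left nhdsWithin_le_nhds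
  have : H z ≤ H w - s * (w - z) := by
    refine ge_of_tendsto hlim' ?_
    filter_upwards [hlim.eventually h, self_mem_nhdsWithin] with t ht ht0
    have ht0 : 0 < t := ht0
    have hconv := hH.2 (mem_univ w) (mem_univ (z - t * (w - z)))
      (by positivity : 0 ≤ t / (1 + t)) (by positivity : 0 ≤ 1 / (1 + t)) (by field_simp; ring)
    have e : (t / (1 + t)) • w + (1 / (1 + t)) • (z - t * (w - z)) = z := by
      simp only [smul_eq_mul]; field_simp; ring
    rw [e] at hconv
    simp only [smul_eq_mul] at hconv
    have h2 : (1 + t) * H z ≤ t * H w + H (z - t * (w - z)) := by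
      have e2 : t / (1 + t) * H w + 1 / (1 + t) * H (z - t * (w - z))
        = (t * H w + H (z - t * (w - z))) / (1 + t) := by ring
      rw [e2, le_div_iff₀ (by positivity)] at hconv
      linarith
    have h3 : t * H z ≤ t * (H w - s * (w - z) + C * t * (w - z) ^ 2) := by nlinarith
    exact le_of_mul_le_mul_left h3 ht0
  linarith

/-- Jensen's lemma in dimension one: if the maxima over `[A, B]` of small linear perturbations of a
semiconvex function are interior, then some of them lie in any given set of full measure. -/
theorem exists_perturbed_max_mem_of_ae {h : ℝ → ℝ} {n A B r : ℝ} (hn : 0 ≤ n) (hAB : A ≤ B)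
    (hr : 0 < r)
    (hconv : ConvexOn ℝ univ (fun z => h z + n * z ^ 2))
    (hint : ∀ q, |q| < r → ∀ z ∈ Icc A B, (∀ w ∈ Icc A B, h w ≤ h z + q * (w - z)) → z ∈ Ioo A B)
    {P : ℝ → Prop} (hP : ∀ᵐ z, P z) :
    ∃ q, |q| < r ∧ ∃ z ∈ Ioo A B, P z ∧ ∀ w ∈ Icc A B, h w ≤ h z + q * (w - z) := by
  -- Otherwise the set `S` of maximisers is null. The slope is a Lipschitz function on `S`, so its
  -- image is null too; yet it contains every slope in `(-r, r)`.
  by_contra! hcon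
  have hcont : Continuous h := by
    have h1 : Continuous (fun z => h z + n * z ^ 2) := by
      rw [← continuousOn_univ]; exact hconv.continuousOn isOpen_univ
    have h2 : Continuous (fun z => (h z + n * z ^ 2) - n * z ^ 2) := by fun_prop
    simpa using h2
  have hex : ∀ q, |q| < r → ∃ z ∈ Ioo A B, ∀ w ∈ Icc A B, h w ≤ h z + q * (w - z) := by
    intro q hq
    obtain ⟨z, hz, hmax⟩ := isCompact_Icc.exists_isMaxOn (nonempty_Icc.2 hAB)
      (f := fun z => h z - q * z) (by fun_prop)
    have : ∀ w ∈ Icc A B, h w ≤ h z + q * (w - z) := fun w hw => by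
      have := hmax hw
      simp only [mem_ofPred_eq] at this
      linarith
    exact ⟨z, hint q hq z hz this, this⟩
  -- Semiconvexity turns contact from above by a line into contact from below by a parabola with the
  -- same slope. The two-sided contact gives both uniqueness of the slope and the constant `2 * n`
  -- below.
  have hsub : ∀ z ∈ Ioo A B, ∀ q, (∀ w ∈ Icc A B, h w ≤ h z + q * (w - z)) →
      ∀ w, h z + q * (w - z) - n * (w - z) ^ 2 ≤ h w := by
    intro z hz q hq w
    have := hconv.tangent_le_of_eventually_le (z := z) (s := q + 2 * n * z) (C := n) (by
      filter_upwards [Icc_mem_nhds hz.1 hz.2] with w hw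
      nlinarith [hq w hw]) w
    nlinarith
  set S : Set ℝ := {z | z ∈ Ioo A B ∧ ∃ q, |q| < r ∧ ∀ w ∈ Icc A B, h w ≤ h z + q * (w - z)}
  have hSnull : MeasureTheory.volume S = 0 := by
    refine MeasureTheory.measure_mono_null ?_ (MeasureTheory.ae_iff.1 hP)
    rintro z ⟨hz, q, hq, hm⟩ hPz
    obtain ⟨w, hw, hlt⟩ := hcon q hq z hz hPz
    exact absurd (hm w hw) (not_le.2 hlt)
  have hlip : ∀ z₁ ∈ Ioo A B, ∀ z₂ ∈ Ioo A B, ∀ q₁ q₂,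
      (∀ w ∈ Icc A B, h w ≤ h z₁ + q₁ * (w - z₁)) →
      (∀ w ∈ Icc A B, h w ≤ h z₂ + q₂ * (w - z₂)) → |q₁ - q₂| ≤ 2 * n * |z₁ - z₂| := by
    intro z₁ hz₁ z₂ hz₂ q₁ q₂ h₁ h₂
    rcases eq_or_ne z₁ z₂ with rfl | hne
    · have : q₂ - q₁ = 0 := eq_zero_of_eventually_mul_le_sq (z := z₁) (C := n) (by
        filter_upwards [Icc_mem_nhds hz₁.1 hz₁.2] with w hw
        nlinarith [h₁ w hw, hsub z₁ hz₁ q₂ h₂ w])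
      simp [sub_eq_zero.1 this]
    · have e1 := h₁ z₂ (Ioo_subset_Icc_self hz₂)
      have e2 := h₂ z₁ (Ioo_subset_Icc_self hz₁)
      have e3 := hsub z₁ hz₁ q₁ h₁ z₂
      have e4 := hsub z₂ hz₂ q₂ h₂ z₁
      have hpos : 0 < |z₁ - z₂| := abs_pos.2 (sub_ne_zero.2 hne)
      refine le_of_mul_le_mul_right ?_ hpos
      rw [← abs_mul, mul_assoc, abs_mul_abs_self]
      rw [abs_le]
      constructor <;> nlinarith
  choose! Q hQ using fun z (hz : z ∈ S) => hz.2
  have hQlip : LipschitzOnWith (2 * n).toNNReal Q S := by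
    refine LipschitzOnWith.of_dist_le_mul fun z₁ h₁ z₂ h₂ => ?_
    rw [Real.dist_eq, Real.dist_eq, Real.coe_toNNReal _ (by positivity)]
    exact hlip z₁ h₁.1 z₂ h₂.1 _ _ (hQ z₁ h₁).2 (hQ z₂ h₂).2
  have himg : MeasureTheory.volume (Q '' S) = 0 := by
    have := hQlip.hausdorffMeasure_image_le (d := 1) zero_le_one
    rw [MeasureTheory.hausdorffMeasure_real, hSnull, mul_zero] at this
    exact le_antisymm this bot_le
  have hsubset : Ioo (-r) r ⊆ Q '' S := by
    intro q hq
    have hq' : |q| < r := abs_lt.2 hq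
    obtain ⟨z, hz, hm⟩ := hex q hq'
    have hzS : z ∈ S := ⟨hz, q, hq', hm⟩
    refine ⟨z, hzS, ?_⟩
    have := hlip z hz z hz _ _ (hQ z hzS).2 hm
    simpa [sub_eq_zero] using this
  have := MeasureTheory.measure_mono_null hsubset himg
  rw [Real.volume_Ioo] at this
  simp at this
  linarith

/-! ### Sup-convolutions -/

/-- Existence of the sup-convolution of an upper semicontinuous function over a compact set. -/
theorem UpperSemicontinuous.exists_supConvolution {v : ℝ → ℝ} (hv : UpperSemicontinuous v)
    {K : Set ℝ} (hK : IsCompact K) (hne : K.Nonempty) (n : ℝ) :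
    ∃ f : ℝ → ℝ, ConvexOn ℝ univ (fun z => f z + n / 2 * z ^ 2) ∧
      (∀ z, ∀ x ∈ K, v x - n / 2 * (x - z) ^ 2 ≤ f z) ∧
      ∀ z, ∃ x ∈ K, f z = v x - n / 2 * (x - z) ^ 2 := by
  have hex : ∀ z, ∃ x ∈ K, ∀ w ∈ K, v w - n / 2 * (w - z) ^ 2 ≤ v x - n / 2 * (x - z) ^ 2 := by
    intro z
    have husc : UpperSemicontinuousOn (fun x => v x + -(n / 2 * (x - z) ^ 2)) K :=
      (hv.add (Continuous.upperSemicontinuous (by fun_prop))).upperSemicontinuousOn K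
    obtain ⟨x, hx, hmax⟩ := husc.exists_isMaxOn hne hK
    exact ⟨x, hx, fun w hw => by simpa [sub_eq_add_neg] using hmax hw⟩
  choose ξ hξK hξ using hex
  -- `n / 2 * z ^ 2 - n / 2 * (x - z) ^ 2` is affine in `z`, so adding the square gives a supremum
  -- of affine functions.
  refine ⟨fun z => v (ξ z) - n / 2 * (ξ z - z) ^ 2, ⟨convex_univ, ?_⟩, fun z x hx => hξ z x hx,
    fun z => ⟨ξ z, hξK z, rfl⟩⟩
  intro z₁ _ z₂ _ s t hs ht hst
  simp only [smul_eq_mul]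
  set z := s * z₁ + t * z₂ with hz
  have e1 := hξ z₁ (ξ z) (hξK z)
  have e2 := hξ z₂ (ξ z) (hξK z)
  have e1' := mul_le_mul_of_nonneg_left e1 hs
  have e2' := mul_le_mul_of_nonneg_left e2 ht
  obtain rfl : t = 1 - s := by linarith
  have : v (ξ z) - n / 2 * (ξ z - z) ^ 2 + n / 2 * z ^ 2 =
      s * (v (ξ z) - n / 2 * (ξ z - z₁) ^ 2 + n / 2 * z₁ ^ 2) +
      (1 - s) * (v (ξ z) - n / 2 * (ξ z - z₂) ^ 2 + n / 2 * z₂ ^ 2) := by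
    rw [hz]; ring
  rw [this]
  linarith

/-- A second-order expansion of the sup-convolution at `z` yields parabolas which touch the original
function from above at the point `x` where the supremum is attained. -/
theorem isLocalMax_of_supConvolution {v f : ℝ → ℝ} {n : ℝ} {K : Set ℝ}
    (hf : ∀ z, ∀ x ∈ K, v x - n / 2 * (x - z) ^ 2 ≤ f z) {x z p X : ℝ} (hx : K ∈ 𝓝 x)
    (hxz : f z = v x - n / 2 * (x - z) ^ 2) (hT : HasSecondOrderExpansion f z p X) :
    p = n * (x - z) ∧ ∀ η > 0, ∀ t : ℝ, IsLocalMax (fun w => v w -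
      (p * (w - x) + ((X + η) * t ^ 2 + n * (1 - t) ^ 2) / 2 * (w - x) ^ 2)) x := by
  have hp : n * (x - z) - p = 0 := by
    refine eq_zero_of_eventually_mul_le_sq (z := z) (C := X / 2 + 1 + n / 2) ?_
    filter_upwards [hT 1 one_pos] with w hw
    have h1 := (abs_le.1 hw).2
    have h2 := hf w x (mem_of_mem_nhds hx)
    nlinarith
  have hp : p = n * (x - z) := by linarith
  refine ⟨hp, fun η hη t => ?_⟩
  -- As `w` moves from `x`, `z` is moved `t` times as far. The expansion of `f` contributes
  -- curvature `X t²` and the penalty `n (1 - t)²`, while the slope is `p` for every `t`.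
  have hlim : Tendsto (fun w => z + t * (w - x)) (𝓝 x) (𝓝 z) := by
    have : Continuous (fun w => z + t * (w - x)) := by fun_prop
    simpa using this.tendsto x
  filter_upwards [hx, hlim.eventually (hT (η / 2) (half_pos hη))] with w hw hTw
  have h1 := (abs_le.1 hTw).2
  have h2 := hf (z + t * (w - x)) w hw
  simp only [sub_self]
  rw [hp] at h1 ⊢
  nlinarith

/-! ### Penalisation and the theorem on sums -/

/-- Penalisation: almost maximisers of `v x + w y - n / 4 (x - y)²` are interior and close to the
diagonal once `n` is large. -/
theorem exists_penalization {v w : ℝ → ℝ} (hv : UpperSemicontinuous v)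
    (hw : UpperSemicontinuous w) {A B M : ℝ} (hM : ∀ x ∈ Icc A B, v x + w x ≤ M)
    (hA : v A + w A < M) (hB : v B + w B < M) {η : ℝ} (hη : 0 < η) :
    ∃ n > 0, ∃ δ > 0, ∀ x ∈ Icc A B, ∀ y ∈ Icc A B,
      M - δ ≤ v x + w y - n / 4 * (x - y) ^ 2 →
        x ∈ Ioo A B ∧ y ∈ Ioo A B ∧ n * (x - y) ^ 2 ≤ η ∧ |x - y| ≤ η := by
  by_contra! hcon
  choose! x hx y hy hxy hbad using fun k : ℕ =>
    hcon (k + 1 : ℝ) (by positivity) (1 / (k + 1 : ℝ)) (by positivity)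
  obtain ⟨⟨X, Y⟩, hXY, φ, hφ, hlim⟩ := (isCompact_Icc.prod isCompact_Icc).tendsto_subseq
    (x := fun k => (x k, y k)) (fun k => ⟨hx k, hy k⟩)
  have hlx : Tendsto (fun k => x (φ k)) atTop (𝓝 X) := (continuous_fst.tendsto _).comp hlim
  have hly : Tendsto (fun k => y (φ k)) atTop (𝓝 Y) := (continuous_snd.tendsto _).comp hlim
  have hk : Tendsto (fun k => ((φ k : ℕ) : ℝ) + 1) atTop atTop :=
    tendsto_atTop_add_const_right _ _ (tendsto_natCast_atTop_atTop.comp hφ.tendsto_atTop)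
  have hk' : Tendsto (fun k => 1 / (((φ k : ℕ) : ℝ) + 1)) atTop (𝓝 0) := by
    simpa only [one_div, Function.comp_def] using tendsto_inv_atTop_zero.comp hk
  have husc : ∀ ε > 0, ∀ᶠ k in atTop, v (x (φ k)) + w (y (φ k)) < v X + w Y + ε := by
    intro ε hε
    filter_upwards [hlx.eventually (hv X (v X + ε / 2) (by linarith)),
      hly.eventually (hw Y (w Y + ε / 2) (by linarith))] with k h1 h2
    linarith
  -- Semicontinuity bounds `v + w` along the sequence, so the penalty stays bounded while its
  -- coefficient tends to infinity.
  have hsq : Tendsto (fun k => (x (φ k) - y (φ k)) ^ 2) atTop (𝓝 0) := by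
    have hbd : Tendsto (fun k => 4 * (v X + w Y + 1 - M + 1) * (1 / (((φ k : ℕ) : ℝ) + 1)))
        atTop (𝓝 0) := by simpa using hk'.const_mul (4 * (v X + w Y + 1 - M + 1))
    refine squeeze_zero' (Eventually.of_forall fun k => sq_nonneg _) ?_ hbd
    filter_upwards [husc 1 one_pos] with k hk1
    have h1 := hxy (φ k)
    have hpos : (0 : ℝ) < (φ k : ℝ) + 1 := by positivity
    have h2 : 1 / ((φ k : ℝ) + 1) ≤ 1 := by
      rw [div_le_one hpos]; linarith [(Nat.cast_nonneg (φ k) : (0 : ℝ) ≤ φ k)]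
    rw [mul_one_div, le_div_iff₀ hpos]
    nlinarith
  obtain rfl : X = Y := by
    have := tendsto_nhds_unique hsq ((hlx.sub hly).pow 2)
    exact sub_eq_zero.1 ((pow_eq_zero_iff two_ne_zero).1 this.symm)
  have hXM : M ≤ v X + w X := by
    refine le_of_forall_pos_le_add fun ε hε => ?_
    obtain ⟨k, h1, h2⟩ := ((husc (ε / 2) (half_pos hε)).and
      (hk'.eventually (gt_mem_nhds (half_pos hε)))).exists
    have h3 := hxy (φ k)
    have : 0 ≤ ((φ k : ℝ) + 1) / 4 * (x (φ k) - y (φ k)) ^ 2 := by positivity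
    linarith
  have hXint : X ∈ Ioo A B := by
    refine ⟨lt_of_le_of_ne hXY.1.1 ?_, lt_of_le_of_ne hXY.1.2 ?_⟩
    · rintro rfl; linarith
    · rintro rfl; linarith
  have hsmall : ∀ᶠ k in atTop, |x (φ k) - y (φ k)| < η := by
    have : Tendsto (fun k => |x (φ k) - y (φ k)|) atTop (𝓝 0) := by
      simpa using (hlx.sub hly).abs
    exact this.eventually (gt_mem_nhds hη)
  -- The semicontinuity error and `δ` are each at most `η / 8`; the factor `4` from the penalty
  -- turns their sum into `η`.
  obtain ⟨k, h1, h2, h3, h4, h5⟩ := ((husc (η / 8) (by positivity)).and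
    ((hk'.eventually (gt_mem_nhds (by positivity : 0 < η / 8))).and
    ((hlx.eventually (Ioo_mem_nhds hXint.1 hXint.2)).and
    ((hly.eventually (Ioo_mem_nhds hXint.1 hXint.2)).and hsmall)))).exists
  have h6 := hxy (φ k)
  have h7 := hM X hXY.1
  have := hbad (φ k) h3 h4 (by linarith)
  linarith

/-- With `s = √a(x)` and `s' = √a(y)`, this `t` selects the touching parabola used in the
comparison; it also covers the degenerate case `s = 0`. -/
theorem exists_mul_eq_min {s s' : ℝ} (hs : 0 ≤ s) (hs' : 0 ≤ s') : ∃ t, s * t = min s s' := by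
  rcases hs.eq_or_lt with rfl | hpos
  · exact ⟨0, by simp [hs']⟩
  · exact ⟨min s s' / s, by field_simp⟩

theorem Continuous.exists_uniform_modulus {H : ℝ → ℝ} (hH : Continuous H) (R : ℝ) {ε : ℝ}
    (hε : 0 < ε) : ∃ r > 0, ∀ p, |p| ≤ R → ∀ q, |q| < r → H (p - q) - H p ≤ ε := by
  have huc := (isCompact_Icc (a := -(R + 1)) (b := R + 1)).uniformContinuousOn_of_continuous
    hH.continuousOn
  obtain ⟨r, hr, h⟩ := Metric.uniformContinuousOn_iff.1 huc ε hε
  refine ⟨min r 1, by positivity, fun p hp q hq => ?_⟩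
  have hp' := abs_le.1 hp
  have hq1 := abs_lt.1 (hq.trans_le (min_le_right _ _))
  have := h (p - q) ⟨by linarith, by linarith⟩ p ⟨by linarith, by linarith⟩
    (by rw [Real.dist_eq]; simpa using hq.trans_le (min_le_left _ _))
  exact (le_abs_self _).trans this.le

/-- One-dimensional theorem on sums: after a linear perturbation of size `r`, the penalised sum
`v x + w y - n / 4 (x - y)²` has almost maximisers at which `v` and `w` are touched from above by
parabolas whose slopes and curvatures match. -/
theorem exists_matching_parabolas {v w : ℝ → ℝ} (hv : UpperSemicontinuous v)
    (hw : UpperSemicontinuous w) {A B n r : ℝ} (hAB : A ≤ B) (hn : 0 < n) (hr : 0 < r)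
    (hrn : r ≤ n) :
    ∃ q, |q| < r ∧ ∃ x ∈ Icc A B, ∃ y ∈ Icc A B, ∃ p p' X Y : ℝ, p + p' = q ∧ X + Y ≤ 0 ∧
      (∀ x₀ ∈ Icc A B,
        v x₀ + w x₀ - |q| * (B - A + 2) ≤ v x + w y - n / 4 * (x - y) ^ 2) ∧
      (x ∈ Ioo A B → |p| ≤ n * (B - A + 1) ∧ ∀ η > 0, ∀ t : ℝ, IsLocalMax (fun s => v s -
        (p * (s - x) + ((X + η) * t ^ 2 + n * (1 - t) ^ 2) / 2 * (s - x) ^ 2)) x) ∧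
      (y ∈ Ioo A B → ∀ η > 0, ∀ t : ℝ, IsLocalMax (fun s => w s -
        (p' * (s - y) + ((Y + η) * t ^ 2 + n * (1 - t) ^ 2) / 2 * (s - y) ^ 2)) y) := by
  obtain ⟨f, hfc, hfle, hfex⟩ := hv.exists_supConvolution (isCompact_Icc (a := A) (b := B))
    (nonempty_Icc.2 hAB) n
  obtain ⟨g, hgc, hgle, hgex⟩ := hw.exists_supConvolution (isCompact_Icc (a := A) (b := B))
    (nonempty_Icc.2 hAB) n
  -- One unit outside `[A, B]` each sup-convolution has dropped by `n / 2`, their sum by `n`. A tilt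
  -- of slope less than `r ≤ n` therefore cannot have its maximum at `A - 1` or `B + 1`.
  have hdecr : ∀ {v f : ℝ → ℝ}, (∀ z, ∀ x ∈ Icc A B, v x - n / 2 * (x - z) ^ 2 ≤ f z) →
      (∀ z, ∃ x ∈ Icc A B, f z = v x - n / 2 * (x - z) ^ 2) →
      f (A - 1) + n / 2 ≤ f A ∧ f (B + 1) + n / 2 ≤ f B := by
    intro v f hle hex
    constructor
    · obtain ⟨x, hx, e⟩ := hex (A - 1)
      have := hle A x hx
      nlinarith [mul_nonneg hn.le (sub_nonneg.2 hx.1)]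
    · obtain ⟨x, hx, e⟩ := hex (B + 1)
      have := hle B x hx
      nlinarith [mul_nonneg hn.le (sub_nonneg.2 hx.2)]
  obtain ⟨hfA, hfB⟩ := hdecr hfle hfex
  obtain ⟨hgA, hgB⟩ := hdecr hgle hgex
  obtain ⟨q, hq, z, hz, ⟨⟨p, X, hT⟩, ⟨p', Y, hT'⟩⟩, hzmax⟩ :=
    exists_perturbed_max_mem_of_ae (h := fun z => f z + g z) (n := n) (A := A - 1) (B := B + 1)
      (r := r)
      (P := fun z => (∃ p X, HasSecondOrderExpansion (fun z => f z + n / 2 * z ^ 2) z p X) ∧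
        ∃ p X, HasSecondOrderExpansion (fun z => g z + n / 2 * z ^ 2) z p X) hn.le (by linarith) hr
      ((hfc.add hgc).congr fun z _ => by simp only [Pi.add_apply]; ring)
      (fun q hq z hz hmax => by
        have hqn := abs_lt.1 (hq.trans_le hrn)
        refine ⟨lt_of_le_of_ne hz.1 ?_, lt_of_le_of_ne hz.2 ?_⟩
        · rintro rfl
          have := hmax A ⟨by linarith, by linarith⟩
          linarith
        · rintro rfl
          have := hmax B ⟨by linarith, by linarith⟩
          linarith)
      (hfc.ae_hasSecondOrderExpansion.and hgc.ae_hasSecondOrderExpansion)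
  replace hT := hT.sub_parabola
  replace hT' := hT'.sub_parabola
  set P := p - n * z
  set P' := p' - n * z
  set S := X - n
  set S' := Y - n
  have hsum : ∀ ε > 0, ∀ᶠ t in 𝓝 z,
      (P + P' - q) * (t - z) + (S + S') / 2 * (t - z) ^ 2 ≤ 2 * ε * (t - z) ^ 2 := by
    intro ε hε
    filter_upwards [hT ε hε, hT' ε hε, Icc_mem_nhds hz.1 hz.2] with t h1 h2 h3
    have := hzmax t h3
    nlinarith [(abs_le.1 h1).1, (abs_le.1 h2).1]
  have hPq : P + P' - q = 0 := by
    refine eq_zero_of_eventually_mul_le_sq (z := z) (C := 2 - (S + S') / 2) ?_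
    filter_upwards [hsum 1 one_pos] with t ht
    nlinarith
  have hSS : S + S' ≤ 0 := by
    refine le_of_forall_pos_le_add fun ε hε => ?_
    have := nonpos_of_eventually_mul_sq_le_zero (X := (S + S') / 2 - 2 * (ε / 4)) (z := z) (by
      filter_upwards [hsum (ε / 4) (by positivity)] with t ht
      rw [hPq] at ht
      nlinarith)
    linarith
  obtain ⟨x, hx, hfx⟩ := hfex z
  obtain ⟨y, hy, hgy⟩ := hgex z
  refine ⟨q, hq, x, hx, y, hy, P, P', S, S', by linarith, hSS, fun x₀ hx₀ => ?_, fun hxI => ?_,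
    fun hyI => (isLocalMax_of_supConvolution hgle (Icc_mem_nhds hyI.1 hyI.2) hgy hT').2⟩
  · have h1 := hzmax x₀ ⟨by linarith [hx₀.1], by linarith [hx₀.2]⟩
    have h2 := hfle x₀ x₀ hx₀
    have h3 := hgle x₀ x₀ hx₀
    have h4 : |q * (x₀ - z)| ≤ |q| * (B - A + 2) := by
      rw [abs_mul]
      refine mul_le_mul_of_nonneg_left ?_ (abs_nonneg q)
      rw [abs_le]
      constructor <;> linarith [hx₀.1, hx₀.2, hz.1, hz.2]
    have h5 := (abs_le.1 h4).2
    simp only [sub_self] at h2 h3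
    -- `2 (x - z)² + 2 (y - z)² = (x - y)² + (x + y - 2 z)²`, which is why the penalty has
    -- coefficient `n / 4`.
    nlinarith [mul_nonneg hn.le (sq_nonneg (x + y - 2 * z))]
  · obtain ⟨hP, htouch⟩ := isLocalMax_of_supConvolution hfle (Icc_mem_nhds hxI.1 hxI.2) hfx hT
    refine ⟨?_, htouch⟩
    rw [hP, abs_mul, abs_of_pos hn]
    refine mul_le_mul_of_nonneg_left ?_ hn.le
    rw [abs_le]
    constructor <;> linarith [hx.1, hx.2, hz.1, hz.2]

/-! ### Comparison on bounded intervals -/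

/-- Comparison on a bounded interval between a strict subsolution and a supersolution of
`-a(x) u'' + H(u') + W(x) = l`, tested with parabolas. -/
theorem strict_comparison_Icc {a H W : ℝ → ℝ} {κ L : ℝ≥0} {l c : ℝ} (hc : 0 < c)
    (ha : ∀ x, a x ∈ Icc (0 : ℝ) 1) (haLip : LipschitzWith κ (fun x => Real.sqrt (a x)))
    (hW : LipschitzWith L W) (hH : Continuous H) {A B : ℝ} {u v : ℝ → ℝ}
    (hu : LowerSemicontinuous u) (hv : UpperSemicontinuous v)
    (hsub : ∀ x ∈ Ioo A B, ∀ p X,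
      IsLocalMax (fun z => v z - (p * (z - x) + X / 2 * (z - x) ^ 2)) x →
        -a x * X + H p + W x ≤ l - c)
    (hsup : ∀ x ∈ Ioo A B, ∀ p X,
      IsLocalMin (fun z => u z - (p * (z - x) + X / 2 * (z - x) ^ 2)) x →
        l ≤ -a x * X + H p + W x) :
    ∀ x ∈ Icc A B, v x - u x ≤ max (v A - u A) (v B - u B) := by
  intro x₁ hx₁
  by_contra! hlt
  have hAB : A ≤ B := hx₁.1.trans hx₁.2
  set w : ℝ → ℝ := fun x => -u x with hw_def
  have hw : UpperSemicontinuous w := hu.neg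
  obtain ⟨x₀, hx₀, hmax⟩ := ((hv.add hw).upperSemicontinuousOn (Icc A B)).exists_isMaxOn
    ⟨x₁, hx₁⟩ isCompact_Icc
  have hM : ∀ x ∈ Icc A B, v x + w x ≤ v x₀ + w x₀ := fun x hx => hmax hx
  have hM₁ := hM x₁ hx₁
  obtain ⟨hAlt, hBlt⟩ := max_lt_iff.1 hlt
  -- The errors from curvature, `√a` and `W` add up to `(2 + κ² + L) η ≤ c / 4`; the tilt in `H`
  -- costs `c / 2`, and the total stays below `c`.
  set η : ℝ := c / (8 * (κ ^ 2 + L + 1)) with hη_def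
  have hden : (0 : ℝ) < 8 * (κ ^ 2 + L + 1) := by positivity
  have hη : 0 < η := by positivity
  have hη8 : 8 * (κ ^ 2 + L + 1) * η = c := by rw [hη_def]; field_simp
  obtain ⟨n, hn, δ, hδ, hpen⟩ := exists_penalization hv hw hM
    (by simp only [hw_def] at hM₁ ⊢; linarith) (by simp only [hw_def] at hM₁ ⊢; linarith) hη
  -- `n` is fixed before the size of the tilt, so slopes stay in a compact set on which `H` is
  -- uniformly continuous.
  obtain ⟨r₁, hr₁, hmod⟩ := hH.exists_uniform_modulus (n * (B - A + 1)) (half_pos hc)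
  have hBA : 0 < B - A + 2 := by linarith
  obtain ⟨q, hq, x, hx, y, hy, P, P', S, S', hPq, hSS, hval, hxt, hyt⟩ :=
    exists_matching_parabolas hv hw hAB hn (r := min (min n r₁) (δ / (B - A + 2)))
      (by positivity) ((min_le_left _ _).trans (min_le_left _ _))
  have hqr₁ : |q| < r₁ := hq.trans_le ((min_le_left _ _).trans (min_le_right _ _))
  have hqδ : |q| * (B - A + 2) ≤ δ := by
    rw [← le_div_iff₀ hBA]; exact (hq.trans_le (min_le_right _ _)).le
  obtain ⟨hxI, hyI, hxy1, hxy2⟩ := hpen x hx y hy (by linarith [hval x₀ hx₀])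
  obtain ⟨hPbd, htouch⟩ := hxt hxI
  have htouch' := hyt hyI
  -- With these choices `S` and `S'` both receive the weight `m²`, so `S + S' ≤ 0` applies, and what
  -- remains is `n (sx - sy)²`, one of `sx - m`, `sy - m` being zero.
  obtain ⟨t, ht⟩ := exists_mul_eq_min (Real.sqrt_nonneg (a x)) (Real.sqrt_nonneg (a y))
  obtain ⟨t', ht'⟩ := exists_mul_eq_min (Real.sqrt_nonneg (a y)) (Real.sqrt_nonneg (a x))
  rw [min_comm] at ht'
  set sx := Real.sqrt (a x) with hsx
  set sy := Real.sqrt (a y) with hsy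
  set m := min sx sy with hm
  have hax : a x = sx ^ 2 := (Real.sq_sqrt (ha x).1).symm
  have hay : a y = sy ^ 2 := (Real.sq_sqrt (ha y).1).symm
  have h1 := hsub x hxI _ _ (htouch η hη t)
  have h2 := hsup y hyI (-P') (-((S' + η) * t' ^ 2 + n * (1 - t') ^ 2)) (by
    have := (htouch' η hη t').neg
    refine this.congr (Eventually.of_forall fun s => ?_)
    simp only [hw_def]
    ring)
  have e1 : a x * ((S + η) * t ^ 2 + n * (1 - t) ^ 2) = (S + η) * m ^ 2 + n * (sx - m) ^ 2 := by
    rw [hax, ← ht]; ring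
  have e2 : a y * ((S' + η) * t' ^ 2 + n * (1 - t') ^ 2) =
      (S' + η) * m ^ 2 + n * (sy - m) ^ 2 := by
    rw [hay, ← ht']; ring
  have hmm : (sx - m) ^ 2 + (sy - m) ^ 2 = (sx - sy) ^ 2 := by
    rcases le_total sx sy with h | h
    · rw [hm, min_eq_left h]; ring
    · rw [hm, min_eq_right h]; ring
  have hm0 : 0 ≤ m := le_min (Real.sqrt_nonneg _) (Real.sqrt_nonneg _)
  have hm1 : m ^ 2 ≤ 1 := by
    have : m ^ 2 ≤ sx ^ 2 := pow_le_pow_left₀ hm0 (min_le_left _ _) 2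
    linarith [(ha x).2]
  have hLa : (sx - sy) ^ 2 ≤ κ ^ 2 * (x - y) ^ 2 := by
    have := haLip.dist_le_mul x y
    rw [Real.dist_eq, Real.dist_eq] at this
    have := pow_le_pow_left₀ (abs_nonneg _) this 2
    rwa [mul_pow, sq_abs, sq_abs] at this
  have hLW : W y - W x ≤ L * η := by
    have := hW.dist_le_mul y x
    rw [Real.dist_eq, Real.dist_eq, abs_sub_comm y x] at this
    exact (le_abs_self _).trans (this.trans (by gcongr))
  have hH' : H (-P') - H P ≤ c / 2 := by
    have : -P' = P - q := by linarith
    rw [this]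
    exact hmod P hPbd q hqr₁
  have hn2 : n * (sx - sy) ^ 2 ≤ κ ^ 2 * η := by
    calc n * (sx - sy) ^ 2 ≤ n * (κ ^ 2 * (x - y) ^ 2) := by gcongr
      _ = κ ^ 2 * (n * (x - y) ^ 2) := by ring
      _ ≤ κ ^ 2 * η := by gcongr
  have hmS : (S + S' + 2 * η) * m ^ 2 ≤ 2 * η := by
    have i1 := mul_nonneg (neg_nonneg.2 hSS) (sq_nonneg m)
    have i2 := mul_le_mul_of_nonneg_left hm1 hη.le
    linarith
  have hκη : 0 ≤ (κ : ℝ) ^ 2 * η := by positivity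
  have hLη : 0 ≤ (L : ℝ) * η := by positivity
  have e3 : n * (sx - m) ^ 2 + n * (sy - m) ^ 2 = n * (sx - sy) ^ 2 := by rw [← hmm]; ring
  rw [neg_mul] at h1 h2
  linarith

/-! ### Growth at infinity -/

theorem HasSublinearUpperGrowth.eventually_le {v : ℝ → ℝ} (hv : HasSublinearUpperGrowth v) {ε : ℝ}
    (hε : 0 < ε) : ∀ᶠ x in absAtTop, v x ≤ ε * (1 + |x|) := by
  have := eventually_lt_of_limsup_lt (lt_of_le_of_lt hv (EReal.coe_pos.2 hε))
  filter_upwards [this] with x hx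
  rw [EReal.coe_lt_coe_iff, div_lt_iff₀ (by positivity)] at hx
  exact hx.le

theorem HasSublinearLowerGrowth.eventually_ge {u : ℝ → ℝ} (hu : HasSublinearLowerGrowth u) {ε : ℝ}
    (hε : 0 < ε) : ∀ᶠ x in absAtTop, -(ε * (1 + |x|)) ≤ u x := by
  have h0 : ((-ε : ℝ) : EReal) < 0 := by
    rw [← EReal.coe_zero, EReal.coe_lt_coe_iff]; linarith
  have := eventually_lt_of_lt_liminf (lt_of_lt_of_le h0 hu)
  filter_upwards [this] with x hx
  rw [EReal.coe_lt_coe_iff, lt_div_iff₀ (by positivity)] at hx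
  linarith

theorem atTop_le_absAtTop : (atTop : Filter ℝ) ≤ absAtTop :=
  tendsto_comap_iff.2 tendsto_abs_atTop_atTop

theorem atBot_le_absAtTop : (atBot : Filter ℝ) ≤ absAtTop :=
  tendsto_comap_iff.2 tendsto_abs_atBot_atTop

instance : NeBot absAtTop := atTop_neBot.mono atTop_le_absAtTop

theorem IsSublinear.hasSublinearUpperGrowth {u : ℝ → ℝ} (hu : IsSublinear u) :
    HasSublinearUpperGrowth u :=
  ((continuous_coe_real_ereal.tendsto _).comp hu).limsup_eq.le

theorem IsSublinear.hasSublinearLowerGrowth {u : ℝ → ℝ} (hu : IsSublinear u) :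
    HasSublinearLowerGrowth u :=
  ((continuous_coe_real_ereal.tendsto _).comp hu).liminf_eq.ge

theorem eventually_perturbation_le {u v : ℝ → ℝ} (hv : HasSublinearUpperGrowth v)
    (hu : HasSublinearLowerGrowth u) {ε b : ℝ} (hε : 0 < ε) (hε1 : ε < 1) (hb : b ≠ 0) (M : ℝ) :
    ∀ᶠ x in absAtTop, b * x ≤ 0 → (1 - ε) * v x + ε * (b * x) - u x ≤ M := by
  have hb' : 0 < |b| := abs_pos.2 hb
  have hη : 0 < ε * |b| / 4 := by positivity
  -- The linear term equals `-4 η |x|`, whereas `v` and `-u` contribute at most `2 η (1 + |x|)`;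
  -- what is left, `2 η (1 - |x|)`, tends to `-∞`.
  set η := ε * |b| / 4 with hη_def
  have hlarge : ∀ᶠ x in absAtTop, 1 - M / (2 * η) ≤ |x| :=
    tendsto_comap.eventually (eventually_ge_atTop _)
  filter_upwards [hv.eventually_le hη, hu.eventually_ge hη, hlarge] with x h1 h2 h3 h4
  have h5 : b * x = -(|b| * |x|) := by rw [← abs_mul, abs_of_nonpos h4, neg_neg]
  have h6 : (1 - ε) * v x ≤ η * (1 + |x|) := by
    have : (1 - ε) * v x ≤ (1 - ε) * (η * (1 + |x|)) :=
      mul_le_mul_of_nonneg_left h1 (by linarith)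
    have : 0 ≤ ε * (η * (1 + |x|)) := by positivity
    linarith
  have h7 : ε * (b * x) = -(4 * η * |x|) := by rw [h5, hη_def]; ring
  have h8 : 2 * η * (1 - |x|) ≤ M := by
    have : (1 - |x|) * (2 * η) ≤ M := by
      rw [← le_div_iff₀ (by positivity)]; linarith
    linarith
  linarith

/-! ### Parabolic test functions and perturbed subsolutions -/

theorem deriv_parabola (p X x : ℝ) :
    deriv (fun z => p * (z - x) + X / 2 * (z - x) ^ 2) x = p ∧
      deriv (deriv (fun z => p * (z - x) + X / 2 * (z - x) ^ 2)) x = X := by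
  have h : ∀ t, HasDerivAt (fun z => p * (z - x) + X / 2 * (z - x) ^ 2) (p + X * (t - x)) t :=
    fun t => ((((hasDerivAt_id t).sub_const x).const_mul p).add
      ((((hasDerivAt_id t).sub_const x).pow 2).const_mul (X / 2))).congr_deriv (by simp; ring)
  have h' : HasDerivAt (fun t => p + X * (t - x)) X x :=
    ((((hasDerivAt_id x).sub_const x).const_mul X).const_add p).congr_deriv (by simp)
  refine ⟨by simpa using (h x).deriv, ?_⟩
  rw [funext fun t => (h t).deriv]
  exact h'.deriv

theorem IsViscositySubsolution.le_of_isLocalMax_parabola {F : ℝ → ℝ → ℝ → ℝ} {I : Set ℝ}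
    {v : ℝ → ℝ} (hv : IsViscositySubsolution F I v) {x p X : ℝ} (hx : x ∈ I)
    (h : IsLocalMax (fun z => v z - (p * (z - x) + X / 2 * (z - x) ^ 2)) x) : F x p X ≤ 0 := by
  obtain ⟨h1, h2⟩ := deriv_parabola p X x
  have := hv.2 (fun z => p * (z - x) + X / 2 * (z - x) ^ 2) (by fun_prop) x hx h
  rwa [h1, h2] at this

theorem IsViscositySupersolution.le_of_isLocalMin_parabola {F : ℝ → ℝ → ℝ → ℝ} {I : Set ℝ}
    {u : ℝ → ℝ} (hu : IsViscositySupersolution F I u) {x p X : ℝ} (hx : x ∈ I)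
    (h : IsLocalMin (fun z => u z - (p * (z - x) + X / 2 * (z - x) ^ 2)) x) : 0 ≤ F x p X := by
  obtain ⟨h1, h2⟩ := deriv_parabola p X x
  have := hu.2 (fun z => p * (z - x) + X / 2 * (z - x) ^ 2) (by fun_prop) x hx h
  rwa [h1, h2] at this

/-- Convex combinations of a subsolution with a strictly subsolving linear function are strict
subsolutions. -/
theorem IsViscositySubsolution.perturbation_le {a V G : ℝ → ℝ} {β l θ : ℝ} {I : Set ℝ} {v : ℝ → ℝ}
    (hv : IsViscositySubsolution (viscousHJ a V G β l θ) I v) (hG : ConvexOn ℝ univ G)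
    (hV : ∀ x, V x ≤ 1) (hβ : 0 ≤ β) {ε b : ℝ} (hε : 0 < ε) (hε1 : ε < 1) {x p X : ℝ}
    (hx : x ∈ I) (h : IsLocalMax (fun z => (1 - ε) * v z + ε * (b * z) -
      (p * (z - x) + X / 2 * (z - x) ^ 2)) x) :
    -a x * X + G (θ + p) + β * V x ≤ l - ε * (l - β - G (θ + b)) := by
  have h1ε : 0 < 1 - ε := by linarith
  have hloc : IsLocalMax (fun z => v z - ((p - ε * b) / (1 - ε) * (z - x) +
      X / (1 - ε) / 2 * (z - x) ^ 2)) x := by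
    filter_upwards [h] with z hz
    simp only [sub_self] at hz ⊢
    have e : v z - ((p - ε * b) / (1 - ε) * (z - x) + X / (1 - ε) / 2 * (z - x) ^ 2) - v x =
        (((1 - ε) * v z + ε * (b * z) - (p * (z - x) + X / 2 * (z - x) ^ 2)) -
          ((1 - ε) * v x + ε * (b * x))) / (1 - ε) := by
      field_simp; ring
    have : v z - ((p - ε * b) / (1 - ε) * (z - x) + X / (1 - ε) / 2 * (z - x) ^ 2) - v x ≤ 0 := by
      rw [e]
      exact div_nonpos_of_nonpos_of_nonneg (by linarith) h1ε.le
    linarith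
  have hF := hv.le_of_isLocalMax_parabola hx hloc
  simp only [viscousHJ] at hF
  -- `θ + p` is the convex combination of the slope tested on `v` and the slope `θ + b` of the
  -- linear function.
  have hconv := hG.2 (mem_univ (θ + (p - ε * b) / (1 - ε))) (mem_univ (θ + b)) h1ε.le hε.le
    (by ring)
  simp only [smul_eq_mul] at hconv
  have e1 : (1 - ε) * (θ + (p - ε * b) / (1 - ε)) + ε * (θ + b) = θ + p := by field_simp; ring
  rw [e1] at hconv
  have h2 := mul_le_mul_of_nonneg_left hF h1ε.le
  have e2 : (1 - ε) * (-a x * (X / (1 - ε)) + G (θ + (p - ε * b) / (1 - ε)) + β * V x - l) =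
      -a x * X + (1 - ε) * G (θ + (p - ε * b) / (1 - ε)) + (1 - ε) * (β * V x - l) := by
    field_simp; ring
  rw [e2] at h2
  have h3 : ε * (β * V x) ≤ ε * β := by
    refine mul_le_mul_of_nonneg_left ?_ hε.le
    nlinarith [hV x]
  linarith

theorem UpperSemicontinuous.perturbation {v : ℝ → ℝ} (hv : UpperSemicontinuous v) {ε : ℝ}
    (hε1 : ε < 1) (b : ℝ) : UpperSemicontinuous (fun z => (1 - ε) * v z + ε * (b * z)) := by
  have h1 : UpperSemicontinuous (fun z => (1 - ε) * v z) :=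
    Continuous.comp_upperSemicontinuous (g := fun t : ℝ => (1 - ε) * t) (by fun_prop) hv
      (fun s t hst => mul_le_mul_of_nonneg_left hst (by linarith))
  exact h1.add (Continuous.upperSemicontinuous (by fun_prop))

/-! ### Comparison on half-lines and the theorem -/

/-- Comparison on the half-line starting from `y` along which the linear function of slope `b`, a
strict subsolution, decreases. -/
theorem comparison_halfLine {κ : ℝ≥0} {a V G : ℝ → ℝ}
    (ha : ∀ x, a x ∈ Icc (0 : ℝ) 1) (haLip : LipschitzWith κ (fun x => Real.sqrt (a x)))
    (hV : ∀ x, V x ≤ 1) (hVLip : LipschitzWith κ V) (hG : ConvexOn ℝ univ G)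
    {β l θ b y : ℝ} (hβ : 0 ≤ β) (hb : b ≠ 0) (hGb : G (θ + b) + β < l) {u v : ℝ → ℝ}
    (hul : LowerSemicontinuous u) (hvu : UpperSemicontinuous v)
    (hu : IsViscositySupersolution (viscousHJ a V G β l θ) {y}ᶜ u)
    (hv : IsViscositySubsolution (viscousHJ a V G β l θ) {y}ᶜ v)
    (hvg : HasSublinearUpperGrowth v) (hug : HasSublinearLowerGrowth u)
    {x : ℝ} (hx : b * (x - y) ≤ 0) : v x - u x ≤ v y - u y := by
  have hGc : Continuous (fun p => G (θ + p)) := by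
    have : Continuous G := by rw [← continuousOn_univ]; exact hG.continuousOn isOpen_univ
    fun_prop
  have hW : LipschitzWith (β.toNNReal * κ) (fun x => β * V x) := by
    refine LipschitzWith.of_dist_le_mul fun s t => ?_
    have := hVLip.dist_le_mul s t
    rw [Real.dist_eq] at this ⊢
    rw [← mul_sub, abs_mul, abs_of_nonneg hβ, NNReal.coe_mul, Real.coe_toNNReal _ hβ, mul_assoc]
    exact mul_le_mul_of_nonneg_left this hβ
  have key : ∀ ε ∈ Ioo (0 : ℝ) 1,
      (1 - ε) * v x + ε * (b * x) - u x ≤ (1 - ε) * v y + ε * (b * y) - u y := by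
    rintro ε ⟨hε, hε1⟩
    have hcomp : ∀ A B, (y ≤ A ∨ B ≤ y) → ∀ x ∈ Icc A B,
        (1 - ε) * v x + ε * (b * x) - u x ≤ max ((1 - ε) * v A + ε * (b * A) - u A)
          ((1 - ε) * v B + ε * (b * B) - u B) := by
      intro A B hAB
      have hsubset : ∀ z ∈ Ioo A B, z ∈ ({y}ᶜ : Set ℝ) := by
        rintro z ⟨h1, h2⟩ rfl
        rcases hAB with h | h <;> linarith
      refine strict_comparison_Icc (l := l) (mul_pos hε (by linarith : 0 < l - β - G (θ + b)))
        ha haLip hW hGc hul (hvu.perturbation hε1 b) (fun z hz p X h => ?_) (fun z hz p X h => ?_)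
      · exact hv.perturbation_le hG hV hβ hε hε1 (hsubset z hz) h
      · have := hu.le_of_isLocalMin_parabola (hsubset z hz) h
        simp only [viscousHJ] at this
        linarith
    -- The far endpoint is chosen where the perturbed difference is below its value at `y`, so the
    -- boundary maximum is the value at `y`.
    have hend := eventually_perturbation_le hvg hug hε hε1 hb
      ((1 - ε) * v y + ε * (b * y) - u y)
    rcases hb.lt_or_gt with hneg | hpos
    · have hyx : y ≤ x := by nlinarith
      obtain ⟨B, h1, h2, h3⟩ := ((hend.filter_mono atTop_le_absAtTop).and
        ((eventually_ge_atTop x).and (eventually_ge_atTop 0))).exists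
      have := hcomp y B (Or.inl le_rfl) x ⟨hyx, h2⟩
      rwa [max_eq_left (h1 (mul_nonpos_of_nonpos_of_nonneg hneg.le h3))] at this
    · have hyx : x ≤ y := by nlinarith
      obtain ⟨A, h1, h2, h3⟩ := ((hend.filter_mono atBot_le_absAtTop).and
        ((eventually_le_atBot x).and (eventually_le_atBot 0))).exists
      have := hcomp A y (Or.inr le_rfl) x ⟨h2, hyx⟩
      rwa [max_eq_right (h1 (mul_nonpos_of_nonneg_of_nonpos hpos.le h3))] at this
  have hlim : ∀ z, Tendsto (fun ε : ℝ => (1 - ε) * v z + ε * (b * z) - u z) (𝓝[>] 0)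
      (𝓝 (v z - u z)) := fun z => by
    have : Continuous (fun ε : ℝ => (1 - ε) * v z + ε * (b * z) - u z) := by fun_prop
    simpa using (this.tendsto 0).mono_left nhdsWithin_le_nhds
  exact le_of_tendsto_of_tendsto (hlim x) (hlim y)
    (by filter_upwards [Ioo_mem_nhdsGT one_pos] with ε hε using key ε hε)

theorem IsViscositySubsolution.mono {F : ℝ → ℝ → ℝ → ℝ} {I J : Set ℝ} {v : ℝ → ℝ}
    (hv : IsViscositySubsolution F I v) (hJ : J ⊆ I) : IsViscositySubsolution F J v :=
  ⟨hv.1.mono hJ, fun φ hφ x hx => hv.2 φ hφ x (hJ hx)⟩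

theorem IsViscositySupersolution.mono {F : ℝ → ℝ → ℝ → ℝ} {I J : Set ℝ} {u : ℝ → ℝ}
    (hu : IsViscositySupersolution F I u) (hJ : J ⊆ I) : IsViscositySupersolution F J u :=
  ⟨hu.1.mono hJ, fun φ hφ x hx => hu.2 φ hφ x (hJ hx)⟩

theorem mainTheorem7
    (α₀ α₁ γ : ℝ) (κ : ℝ≥0) (hα₀ : 0 < α₀) (hα₁ : 0 < α₁) (hγ : 1 < γ) (hκ : 0 < κ)
    (a V G : ℝ → ℝ)
    (ha : ∀ x, a x ∈ Icc (0 : ℝ) 1) (haLip : LipschitzWith κ (fun x => Real.sqrt (a x)))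
    (hV : ∀ x, V x ∈ Icc (0 : ℝ) 1) (hVLip : LipschitzWith κ V)
    (hG1 : ∀ p, α₀ * |p| ^ γ - 1 / α₀ ≤ G p ∧ G p ≤ α₁ * (|p| ^ γ + 1))
    (hG2 : ∀ p q, |G p - G q| ≤ α₁ * (|p| + |q| + 1) ^ (γ - 1) * |p - q|)
    (hG3 : G 0 = 0) (hG4 : ConvexOn ℝ univ G)
    (β l : ℝ) (hβ : 0 < β) (hl : β < l) :
    (∀ (y θ : ℝ) (u v : ℝ → ℝ), LowerSemicontinuous u → UpperSemicontinuous v →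
      IsViscositySupersolution (viscousHJ a V G β l θ) {y}ᶜ u →
      IsViscositySubsolution (viscousHJ a V G β l θ) {y}ᶜ v →
      HasSublinearUpperGrowth v → HasSublinearLowerGrowth u →
        (0 < θ → ∀ x, y ≤ x → v x - u x ≤ v y - u y) ∧
        (θ < 0 → ∀ x, x ≤ y → v x - u x ≤ v y - u y) ∧
        (θ = 0 → (∃ K : ℝ≥0, LipschitzWith K v) → ∀ x, v x - u x ≤ v y - u y)) ∧
    (∀ (θ : ℝ) (u₁ u₂ : ℝ → ℝ), θ ≠ 0 →
      IsViscositySolution (viscousHJ a V G β l θ) univ u₁ →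
      IsViscositySolution (viscousHJ a V G β l θ) univ u₂ →
      IsSublinear u₁ → IsSublinear u₂ →
        ∃ c : ℝ, ∀ x, u₁ x - u₂ x = c) := by
  have hGc : Continuous G := by rw [← continuousOn_univ]; exact hG4.continuousOn isOpen_univ
  have hsmall : ∀ᶠ b in 𝓝 (0 : ℝ), G (0 + b) + β < l := by
    have : Continuous (fun b => G (0 + b) + β) := by fun_prop
    exact this.continuousAt.eventually_lt continuousAt_const (by simpa [hG3] using hl)
  have hstrict : ∀ θ : ℝ, G (θ + -θ) + β < l := fun θ => by simpa [hG3] using hl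
  refine ⟨fun y θ u v hul hvu hu hv hvg hug => ⟨fun hθ x hx => ?_, fun hθ x hx => ?_, ?_⟩, ?_⟩
  · exact comparison_halfLine ha haLip (fun x => (hV x).2) hVLip hG4 hβ.le (neg_ne_zero.2 hθ.ne')
      (hstrict θ) hul hvu hu hv hvg hug (by nlinarith)
  · exact comparison_halfLine ha haLip (fun x => (hV x).2) hVLip hG4 hβ.le (neg_ne_zero.2 hθ.ne)
      (hstrict θ) hul hvu hu hv hvg hug (by nlinarith)
  · rintro rfl - x
    -- By continuity of `G` at `0` both slopes `± δ / 2` are admissible, one for each half-line.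
    obtain ⟨δ, hδ, hball⟩ := Metric.eventually_nhds_iff.1 hsmall
    have hδ' : |δ| / 2 < δ := by rw [abs_of_pos hδ]; linarith
    rcases le_total y x with hx | hx
    · exact comparison_halfLine (b := -(δ / 2)) ha haLip (fun x => (hV x).2) hVLip hG4 hβ.le
        (by linarith) (hball (by simpa [Real.dist_eq] using hδ')) hul hvu hu hv hvg hug
        (by nlinarith)
    · exact comparison_halfLine (b := δ / 2) ha haLip (fun x => (hV x).2) hVLip hG4 hβ.le
        (by positivity) (hball (by simpa [Real.dist_eq] using hδ')) hul hvu hu hv hvg hug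
        (by nlinarith)
  · intro θ u₁ u₂ hθ h₁ h₂ hs₁ hs₂
    have hle : ∀ w₁ w₂ : ℝ → ℝ, IsViscositySolution (viscousHJ a V G β l θ) univ w₁ →
        IsViscositySolution (viscousHJ a V G β l θ) univ w₂ → IsSublinear w₁ → IsSublinear w₂ →
        ∀ x y, -θ * (x - y) ≤ 0 → w₁ x - w₂ x ≤ w₁ y - w₂ y :=
      fun w₁ w₂ k₁ k₂ t₁ t₂ x y hxy =>
        comparison_halfLine ha haLip (fun x => (hV x).2) hVLip hG4 hβ.le (neg_ne_zero.2 hθ)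
          (hstrict θ) (lowerSemicontinuousOn_univ_iff.1 k₂.2.1)
          (upperSemicontinuousOn_univ_iff.1 k₁.1.1) (k₂.2.mono (subset_univ _))
          (k₁.1.mono (subset_univ _)) t₁.hasSublinearUpperGrowth t₂.hasSublinearLowerGrowth hxy
    have heq : ∀ x y, -θ * (x - y) ≤ 0 → u₁ x - u₂ x = u₁ y - u₂ y := fun x y hxy => by
      linarith [hle u₁ u₂ h₁ h₂ hs₁ hs₂ x y hxy, hle u₂ u₁ h₂ h₁ hs₂ hs₁ x y hxy]
    refine ⟨u₁ 0 - u₂ 0, fun x => ?_⟩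
    rcases le_total (-θ * (x - 0)) 0 with h | h
    · exact heq x 0 h
    · exact (heq 0 x (by linarith)).symm
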